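/- For $n\ge 1$ let $P_a=\bigotimes_{k=1}^n i^{a_{x,k}a_{z,k}}X^{a_{x,k}}Z^{a_{z,k}}$, $a\in\mathbb{Z}_2^{2n}$, be the $n$-qubit Pauli operators. A Pauli channel with error rates $q$ (a probability distribution on $\mathbb{Z}_2^{2n}$) is $\Lambda(\rho)=\sum_a q_aP_a\rho P_a$; its Pauli eigenvalues are $\lambda_b=\sum_a q_a(-1)^{\langle a,b\rangle}$, where $\langle a,b\rangle=\sum_k(a_{x,k}b_{z,k}+a_{z,k}b_{x,k})\bmod 2$. A protocol without quantum memory with $T$ measurements runs $T$ rounds. In each round it prepares an $n$-qubit state $\rho$, queries the unknown channel $\Lambda$ some number $M\ge1$ of times, interleaved with data-processing channels (completely positive trace-preserving maps on the same $n$ qubits), so as to obtain $\Lambda(\mathcal{C}_{M-1}(\Lambda(\cdots\mathcal{C}_1(\Lambda(\rho))\cdots)))$, and measures all $n$ qubits of this state with a finite POVM $\{F_s\}$, which gives outcome $s$ with probability $\operatorname{Tr}(F_s\,\cdot)$. The number $M$, the state, the channels and the POVM may depend on all earlier outcomes (adaptivity), and discrete classical randomness may be used. After the last round the protocol outputs,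 as a function of its randomness and the outcomes, estimates $(\hat\lambda_b)_b$. It estimates all Pauli eigenvalues to error $\epsilon$ with probability at least $p$ if, for every Pauli channel $\Lambda$, with probability at least $p$ we have $|\hat\lambda_b-\lambda_b|<\epsilon$ for all $b$. Theorem 3.1. For every constant $p>1/2$ there is a constant $c>0$, depending only on $p$, such that for all $n\ge1$, all $0<\epsilon\le1$ and all $T$: any protocol without quantum memory, even adaptive and concatenating, that makes $T$ measurements and estimates all Pauli eigenvalues of an unknown $n$-qubit Pauli channel to error $\epsilon$ with probability at least $p$ satisfies $T\ge c\,2^n/\epsilon^2$. -/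

import Mathlib

namespace PauliLearning

open scoped ComplexOrder

/-- Basis labels of the `n`-qubit Hilbert space. -/
abbrev Basis (n : ℕ) : Type := Fin n → Fin 2

/-- Linear operators on the `n`-qubit Hilbert space, as `2^n × 2^n` complex matrices. -/
abbrev Op (n : ℕ) : Type := Matrix (Basis n) (Basis n) ℂ

/-- Labels of the `n`-qubit Pauli operators, i.e. elements of `(ℤ/2)^(2n)`. The `k`-th entry is
the pair of bits `(a_{x,k}, a_{z,k})`. -/
abbrev PauliIndex (n : ℕ) : Type := Fin n → ZMod 2 × ZMod 2

/-- The single-qubit Pauli operator `i^(xz) X^x Z^z`. -/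
noncomputable def pauli1 (a : ZMod 2 × ZMod 2) : Matrix (Fin 2) (Fin 2) ℂ :=
  Complex.I ^ (a.1.val * a.2.val) •
    ((!![0, 1; 1, 0] : Matrix (Fin 2) (Fin 2) ℂ) ^ a.1.val *
      (!![1, 0; 0, -1] : Matrix (Fin 2) (Fin 2) ℂ) ^ a.2.val)

/-- The `n`-qubit Pauli operator `P_a`, the tensor product of single-qubit Pauli operators. -/
noncomputable def pauli {n : ℕ} (a : PauliIndex n) : Op n :=
  Matrix.of fun s t => ∏ k, pauli1 (a k) (s k) (t k)

/-- The symplectic inner product on `(ℤ/2)^(2n)`. -/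
def symp {n : ℕ} (a b : PauliIndex n) : ZMod 2 :=
  ∑ k, ((a k).1 * (b k).2 + (a k).2 * (b k).1)

/-- The Pauli channel `ρ ↦ ∑ a, q_a P_a ρ P_a` with Pauli error rates `q`. -/
noncomputable def pauliChannel {n : ℕ} (q : PauliIndex n → ℝ) (ρ : Op n) : Op n :=
  ∑ a, (q a : ℂ) • (pauli a * ρ * pauli a)

/-- The Pauli eigenvalue `λ_b = ∑ a, q_a (-1)^⟨a,b⟩` of the Pauli channel with error rates `q`. -/
noncomputable def pauliEigenvalue {n : ℕ} (q : PauliIndex n → ℝ) (b : PauliIndex n) : ℝ :=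
  ∑ a, q a * (-1) ^ (symp a b).val

/-- An `n`-qubit state (density matrix). -/
structure State (n : ℕ) where
  mat : Op n
  posSemidef : mat.PosSemidef
  trace_eq_one : mat.trace = 1

/-- The map `id_k ⊗ Φ` on operators on `ℂ^k ⊗ (ℂ^2)^{⊗ n}`: apply `Φ` to each of the
`k × k` blocks. -/
def ampliation {n : ℕ} (k : ℕ) (Φ : Op n →ₗ[ℂ] Op n)
    (X : Matrix (Fin k × Basis n) (Fin k × Basis n) ℂ) :
    Matrix (Fin k × Basis n) (Fin k × Basis n) ℂ :=
  Matrix.of fun i j => Φ (Matrix.of fun s t => X (i.1, s) (j.1, t)) i.2 j.2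

/-- An `n`-qubit quantum channel: a completely positive trace-preserving linear map. -/
structure Channel (n : ℕ) where
  map : Op n →ₗ[ℂ] Op n
  completelyPositive : ∀ (k : ℕ) (X : Matrix (Fin k × Basis n) (Fin k × Basis n) ℂ),
    X.PosSemidef → (ampliation k map X).PosSemidef
  tracePreserving : ∀ X : Op n, (map X).trace = X.trace

/-- An `n`-qubit POVM with finitely many outcomes. -/
structure POVM (n : ℕ) where
  outcomes : ℕ
  elt : Fin outcomes → Op n
  posSemidef : ∀ s, (elt s).PosSemidef
  sum_eq_one : ∑ s, elt s = 1

/-- One round of a concatenating protocol without quantum memory: an `n`-qubit input state, the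
data-processing channels `C_1, …, C_{M-1}` on the same `n` qubits that are interleaved with
`M ≥ 1` queries to the unknown channel, and a final POVM on these `n` qubits. The number `M - 1`
is the length of the list, and is arbitrary. -/
structure Round (n : ℕ) where
  input : State n
  processing : List (Channel n)
  povm : POVM n

/-- The state `Λ(C_{M-1}(Λ(⋯ Λ(C_1(Λ(ρ))) ⋯)))` that is measured at the end of a round. -/
def Round.output {n : ℕ} (r : Round n) (Λ : Op n → Op n) : Op n :=
  r.processing.foldl (fun σ C => Λ (C.map σ)) (Λ r.input.mat)

/-- The probability `Tr(F_s ρ_out)` of outcome `s` in a round. -/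
noncomputable def Round.outcomeProb {n : ℕ} (r : Round n) (Λ : Op n → Op n)
    (s : Fin r.povm.outcomes) : ℝ :=
  ((r.povm.elt s * r.output Λ).trace).re

/-- Deterministic adaptive protocols without quantum memory that make exactly `T` measurements,
as learning trees. At each internal node a round is performed, which may depend on all earlier
outcomes, and its outcome selects the child; each leaf outputs estimates of all eigenvalues. -/
inductive LearningTree (n : ℕ) : ℕ → Type
  | leaf (estimate : PauliIndex n → ℝ) : LearningTree n 0
  | node {T : ℕ} (r : Round n) (next : Fin r.povm.outcomes → LearningTree n T) :
      LearningTree n (T + 1)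

open Classical in
/-- The probability that the vector of estimates output by the learning tree lies in `E`, if the
unknown channel is `Λ`: the sum, over the leaves with output in `E`, of the products of the outcome
probabilities along the path to the leaf. -/
noncomputable def LearningTree.prob {n : ℕ} (Λ : Op n → Op n) (E : Set (PauliIndex n → ℝ)) :
    {T : ℕ} → LearningTree n T → ℝ
  | _, .leaf estimate => if estimate ∈ E then 1 else 0
  | _, .node r next => ∑ s, r.outcomeProb Λ s * (next s).prob Λ E

/-- Adaptive, concatenating protocols without quantum memory that make `T` measurements: learning
trees, possibly chosen at random by means of classical randomness. -/
abbrev Protocol (n T : ℕ) : Type := PMF (LearningTree n T)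

/-- The probability that the estimates output by the protocol lie in `E`, if the unknown channel
is `Λ`. -/
noncomputable def Protocol.prob {n T : ℕ} (A : Protocol n T) (Λ : Op n → Op n)
    (E : Set (PauliIndex n → ℝ)) : ℝ :=
  ∑' t, (A t).toReal * t.prob Λ E

/-- The protocol solves Pauli eigenvalue estimation to error `ε` with probability at least `p`:
for each Pauli channel, with probability at least `p` all estimates have error less than `ε`. -/
def Protocol.Solves {n T : ℕ} (A : Protocol n T) (ε p : ℝ) : Prop :=
  ∀ q ∈ stdSimplex ℝ (PauliIndex n),
    p ≤ Protocol.prob A (pauliChannel q) {est | ∀ b, |est b - pauliEigenvalue q b| < ε}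

end PauliLearning

/-
Write `P_a` for the Pauli operators. The unknown channel is either the completely depolarizing
channel `Λ₀` or one of the `2(4^n - 1)` channels `Λ_{a,±ε}` whose only nonzero nontrivial eigenvalue
is `λ_a = ±ε`. A successful protocol tells `Λ_{a,ε}` from `Λ_{a,-ε}`, hence at least one of the two
from `Λ₀`, for every `a ≠ 0`.

Interleaved channels do not help: the state measured in a round is `Λ(ρ)` for some state `ρ`.
Since `Λ_{a,δ}(ρ) = Λ₀(ρ) + δ Tr(P_a ρ) P_a / 2^n`, the outcome `s` has likelihood ratio
`1 + t Tr(P_a F_s) / Tr F_s` relative to `Λ₀`, with `|t| ≤ ε`. By Parseval's identity,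
`∑_a Tr(P_a F_s)² = 2^n Tr F_s² ≤ 2^n (Tr F_s)²`, so a round yields `χ²`-divergences from `Λ₀` of at
most `2^n ε²` summed over all `a`, although there are about `4^n` many `a`. On average over `a`, it
therefore takes at least of the order of `2^n / ε²` rounds to accumulate a constant `χ²`-divergence.

To bound the distance between the output distributions by the accumulated `χ²`-divergences, one
follows `φ(y) = (1 - y)² / (1 + y)` of the likelihood ratio `y` along the tree. This function
controls the total variation distance, and it satisfies `φ(yx) ≤ φ(y) + c_y (x - 1) + 4 (x - 1)²`
for all `x, y ≥ 0`, including vanishing likelihood ratios, where logarithms are unavailable.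
-/

namespace PauliLearning

open scoped ComplexOrder MatrixOrder
open Matrix

section PiKronecker

variable {ι R : Type*} [Fintype ι] [CommRing R] {l m o : ι → Type*}

/-- The tensor product (iterated Kronecker product) of a finite family of matrices, with rows and
columns indexed by tuples. -/
def piKronecker (A : ∀ k, Matrix (l k) (m k) R) : Matrix (∀ k, l k) (∀ k, m k) R :=
  of fun s t => ∏ k, A k (s k) (t k)

lemma piKronecker_one [∀ k, DecidableEq (l k)] [DecidableEq (∀ k, l k)] :
    piKronecker (fun k => (1 : Matrix (l k) (l k) R)) = 1 := by
  ext s t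
  by_cases h : s = t
  · rw [h, one_apply_eq]
    simp only [piKronecker, of_apply, one_apply_eq, Finset.prod_const_one]
  · obtain ⟨k, hk⟩ := Function.ne_iff.mp h
    rw [one_apply_ne h]
    exact Finset.prod_eq_zero (Finset.mem_univ k) (one_apply_ne hk)

lemma piKronecker_smul (c : ι → R) (A : ∀ k, Matrix (l k) (m k) R) :
    piKronecker (fun k => c k • A k) = (∏ k, c k) • piKronecker A := by
  ext s t
  simp [piKronecker, Finset.prod_mul_distrib]

lemma piKronecker_mul [DecidableEq ι] [∀ k, Fintype (m k)] (A : ∀ k, Matrix (l k) (m k) R)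
    (B : ∀ k, Matrix (m k) (o k) R) :
    piKronecker A * piKronecker B = piKronecker fun k => A k * B k := by
  ext s t
  simp [piKronecker, mul_apply, ← Finset.prod_mul_distrib, Fintype.prod_sum]

lemma conjTranspose_piKronecker [StarRing R] (A : ∀ k, Matrix (l k) (m k) R) :
    (piKronecker A)ᴴ = piKronecker fun k => (A k)ᴴ := by
  ext s t
  simp [piKronecker]

lemma trace_piKronecker [DecidableEq ι] [∀ k, Fintype (l k)] (A : ∀ k, Matrix (l k) (l k) R) :
    (piKronecker A).trace = ∏ k, (A k).trace := by
  simp [piKronecker, trace, Fintype.prod_sum]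

end PiKronecker

section PosSemidef

variable {ι : Type*} [Fintype ι]

lemma ofReal_re_trace {X : Matrix ι ι ℂ} (hX : X.IsHermitian) : (X.trace.re : ℂ) = X.trace := by
  rw [← Complex.conj_eq_iff_re, starRingEnd_apply, ← trace_conjTranspose, hX.eq]

lemma ofReal_re_trace_mul {X Y : Matrix ι ι ℂ} (hX : X.IsHermitian) (hY : Y.IsHermitian) :
    ((X * Y).trace.re : ℂ) = (X * Y).trace := by
  rw [← Complex.conj_eq_iff_re, starRingEnd_apply, ← trace_conjTranspose, conjTranspose_mul, hX.eq,
    hY.eq, trace_mul_comm]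

lemma re_trace_nonneg {X : Matrix ι ι ℂ} (hX : X.PosSemidef) : 0 ≤ X.trace.re :=
  (Complex.nonneg_iff.mp hX.trace_nonneg).1

lemma re_trace_mul_nonneg {X Y : Matrix ι ι ℂ} (hX : X.PosSemidef) (hY : Y.PosSemidef) :
    0 ≤ (X * Y).trace.re := by
  classical
  obtain ⟨B, rfl⟩ := CStarAlgebra.nonneg_iff_eq_star_mul_self.mp hX.nonneg
  rw [star_eq_conjTranspose, mul_assoc, trace_mul_comm]
  exact re_trace_nonneg (hY.mul_mul_conjTranspose_same B)

lemma trace_mul_self_le_sq {X : Matrix ι ι ℂ} (hX : X.PosSemidef) :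
    (X * X).trace ≤ X.trace ^ 2 := by
  classical
  simp only [sq, trace, diag_apply, mul_apply, Finset.sum_mul_sum]
  refine Finset.sum_le_sum fun i _ => Finset.sum_le_sum fun j _ => ?_
  have hminor := (hX.submatrix ![i, j]).det_nonneg
  rw [det_fin_two] at hminor
  simpa using hminor

variable [DecidableEq ι]

lemma posSemidef_one_add_of_involution {U : Matrix ι ι ℂ} (hU : U.IsHermitian)
    (hUU : U * U = 1) : (1 + U).PosSemidef := by
  have hsq : (1 + U)ᴴ * (1 + U) = (2 : ℝ) • (1 + U) := by
    rw [conjTranspose_add, conjTranspose_one, hU.eq, mul_add, add_mul, add_mul, hUU]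
    simp only [one_mul, mul_one]
    module
  rw [← inv_smul_smul₀ (two_ne_zero : (2 : ℝ) ≠ 0) (1 + U), ← hsq]
  exact (posSemidef_conjTranspose_mul_self (1 + U)).smul (by positivity)

lemma abs_re_trace_mul_le {U X : Matrix ι ι ℂ} (hU : U.IsHermitian) (hUU : U * U = 1)
    (hX : X.PosSemidef) : |(U * X).trace.re| ≤ X.trace.re := by
  have hplus := re_trace_mul_nonneg (posSemidef_one_add_of_involution hU hUU) hX
  have hminus := re_trace_mul_nonneg
    (posSemidef_one_add_of_involution hU.neg (by rw [neg_mul_neg, hUU])) hX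
  simp only [add_mul, one_mul, neg_mul, trace_add, trace_neg, Complex.add_re, Complex.neg_re]
    at hplus hminus
  exact abs_le.mpr ⟨by linarith, by linarith⟩

end PosSemidef

section Pauli

lemma zmod_two_prod_cases (a : ZMod 2 × ZMod 2) :
    a = (0, 0) ∨ a = (0, 1) ∨ a = (1, 0) ∨ a = (1, 1) := by
  revert a
  decide

lemma pauli1_I : pauli1 (0, 0) = 1 := by
  simp [pauli1]

lemma pauli1_Z : pauli1 (0, 1) = !![1, 0; 0, -1] := by
  simp [pauli1, ZMod.val_one]

lemma pauli1_X : pauli1 (1, 0) = !![0, 1; 1, 0] := by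
  simp [pauli1, ZMod.val_one]

lemma pauli1_Y : pauli1 (1, 1) = !![0, -Complex.I; Complex.I, 0] := by
  simp [pauli1, ZMod.val_one]

lemma pauli1_mul_self (a : ZMod 2 × ZMod 2) : pauli1 a * pauli1 a = 1 := by
  rcases zmod_two_prod_cases a with rfl | rfl | rfl | rfl <;>
    simp [pauli1_I, pauli1_Z, pauli1_X, pauli1_Y, one_fin_two]

lemma pauli1_isHermitian (a : ZMod 2 × ZMod 2) : (pauli1 a).IsHermitian := by
  rcases zmod_two_prod_cases a with rfl | rfl | rfl | rfl <;> ext i j <;>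
    fin_cases i <;> fin_cases j <;> simp [pauli1_I, pauli1_Z, pauli1_X, pauli1_Y]

lemma trace_pauli1 {a : ZMod 2 × ZMod 2} (ha : a ≠ 0) : (pauli1 a).trace = 0 := by
  rcases zmod_two_prod_cases a with rfl | rfl | rfl | rfl
  · exact absurd rfl ha
  all_goals simp [pauli1_Z, pauli1_X, pauli1_Y]

lemma pauli1_mul_comm (a b : ZMod 2 × ZMod 2) :
    pauli1 a * pauli1 b =
      (-1 : ℂ) ^ (a.1 * b.2 + a.2 * b.1).val • (pauli1 b * pauli1 a) := by
  have htwo : (1 + 1 : ZMod 2) = 0 := rfl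
  rcases zmod_two_prod_cases a with rfl | rfl | rfl | rfl <;>
    rcases zmod_two_prod_cases b with rfl | rfl | rfl | rfl <;>
    simp [pauli1_I, pauli1_Z, pauli1_X, pauli1_Y, ZMod.val_one, htwo]

lemma sum_pauli1_mul_pauli1 (s t v u : Fin 2) :
    ∑ a, pauli1 a s t * pauli1 a v u =
      2 * ((1 : Matrix (Fin 2) (Fin 2) ℂ) s u * (1 : Matrix (Fin 2) (Fin 2) ℂ) t v) := by
  have huniv : (Finset.univ : Finset (ZMod 2)) = {0, 1} := rfl
  simp only [Fintype.sum_prod_type, huniv, Finset.sum_pair zero_ne_one, pauli1_I, pauli1_Z,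
    pauli1_X, pauli1_Y]
  fin_cases s <;> fin_cases u <;> fin_cases v <;> fin_cases t <;> norm_num

variable {n : ℕ}

lemma pauli_eq_piKronecker (a : PauliIndex n) : pauli a = piKronecker fun k => pauli1 (a k) := rfl

lemma pauli_mul_self (a : PauliIndex n) : pauli a * pauli a = 1 := by
  rw [pauli_eq_piKronecker, piKronecker_mul]
  simp only [pauli1_mul_self]
  exact piKronecker_one

lemma pauli_isHermitian (a : PauliIndex n) : (pauli a).IsHermitian := by
  rw [IsHermitian, pauli_eq_piKronecker, conjTranspose_piKronecker]
  simp only [(pauli1_isHermitian _).eq]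

lemma trace_pauli {a : PauliIndex n} (ha : a ≠ 0) : (pauli a).trace = 0 := by
  obtain ⟨k, hk⟩ := Function.ne_iff.mp ha
  rw [pauli_eq_piKronecker, trace_piKronecker]
  exact Finset.prod_eq_zero (Finset.mem_univ k) (trace_pauli1 hk)

lemma neg_one_pow_val_sum {R ι : Type*} [CommRing R] (s : Finset ι) (f : ι → ZMod 2) :
    (-1 : R) ^ (∑ i ∈ s, f i).val = ∏ i ∈ s, (-1) ^ (f i).val := by
  classical
  induction s using Finset.induction_on with
  | empty => simp
  | insert i s hi ih =>
    rw [Finset.sum_insert hi, Finset.prod_insert hi, ← ih, ← pow_add, ZMod.val_add,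
      ← neg_one_pow_eq_pow_mod_two]

lemma pauli_mul_comm (a b : PauliIndex n) :
    pauli a * pauli b = (-1 : ℂ) ^ (symp a b).val • (pauli b * pauli a) := by
  simp only [pauli_eq_piKronecker, piKronecker_mul, symp, neg_one_pow_val_sum]
  rw [← piKronecker_smul]
  simp only [← pauli1_mul_comm]

lemma sum_pauli_mul_pauli (s t v u : Basis n) :
    ∑ a, pauli a s t * pauli a v u = 2 ^ n * ((1 : Op n) s u * (1 : Op n) t v) := by
  have hone : (1 : Op n) = piKronecker fun _ => 1 := piKronecker_one.symm
  simp only [hone, piKronecker, pauli, of_apply, ← Finset.prod_mul_distrib]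
  rw [← Fintype.prod_sum fun k j => pauli1 j (s k) (t k) * pauli1 j (v k) (u k)]
  simp only [sum_pauli1_mul_pauli1, Finset.prod_mul_distrib, Finset.prod_const, Finset.card_univ,
    Fintype.card_fin]

lemma sum_pauli_conj (X : Op n) :
    ∑ a, pauli a * X * pauli a = (2 ^ n * X.trace) • (1 : Op n) := by
  ext s t
  calc (∑ a, pauli a * X * pauli a : Op n) s t
      = ∑ v, ∑ u, X u v * ∑ a, pauli a s u * pauli a v t := by
        simp only [Matrix.sum_apply, mul_apply, Finset.sum_mul, Finset.mul_sum]
        rw [Finset.sum_comm]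
        refine Finset.sum_congr rfl fun v _ => Finset.sum_comm.trans ?_
        exact Finset.sum_congr rfl fun u _ => Finset.sum_congr rfl fun a _ => by ring
    _ = _ := by
        simp only [sum_pauli_mul_pauli, one_apply, Matrix.smul_apply, smul_eq_mul]
        simp [trace, Finset.mul_sum, mul_comm, mul_left_comm]

lemma sum_trace_pauli_smul_pauli (X : Op n) :
    ∑ a, (pauli a * X).trace • pauli a = (2 : ℂ) ^ n • X := by
  ext s t
  calc (∑ a, (pauli a * X).trace • pauli a : Op n) s t
      = ∑ u, ∑ v, X v u * ∑ a, pauli a u v * pauli a s t := by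
        simp only [Matrix.sum_apply, Matrix.smul_apply, trace, diag_apply, mul_apply, smul_eq_mul,
          Finset.sum_mul, Finset.mul_sum]
        rw [Finset.sum_comm]
        refine Finset.sum_congr rfl fun u _ => Finset.sum_comm.trans ?_
        exact Finset.sum_congr rfl fun v _ => Finset.sum_congr rfl fun a _ => by ring
    _ = _ := by
        simp only [sum_pauli_mul_pauli, one_apply, Matrix.smul_apply, smul_eq_mul]
        simp [mul_comm]

lemma sum_sign_smul_pauli_conj (a : PauliIndex n) (X : Op n) :
    ∑ b, (-1 : ℂ) ^ (symp a b).val • (pauli b * X * pauli b) =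
      (2 ^ n * (pauli a * X).trace) • pauli a := by
  have hconj : ∀ b, (-1 : ℂ) ^ (symp a b).val • (pauli b * X * pauli b) =
      pauli a * (pauli b * (pauli a * X) * pauli b) := by
    intro b
    calc (-1 : ℂ) ^ (symp a b).val • (pauli b * X * pauli b)
        = (-1 : ℂ) ^ (symp a b).val • (pauli b * pauli a) * (pauli a * X) * pauli b := by
          rw [smul_mul_assoc, smul_mul_assoc, mul_assoc (pauli b) (pauli a),
            ← mul_assoc (pauli a), pauli_mul_self, one_mul]
      _ = pauli a * (pauli b * (pauli a * X) * pauli b) := by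
          rw [← pauli_mul_comm]
          simp only [mul_assoc]
  simp only [hconj]
  rw [← Finset.mul_sum, sum_pauli_conj, mul_smul_comm, mul_one]

lemma sum_sign {a : PauliIndex n} (ha : a ≠ 0) : ∑ b, (-1 : ℝ) ^ (symp a b).val = 0 := by
  have h := sum_sign_smul_pauli_conj a 1
  simp only [mul_one, pauli_mul_self, trace_pauli ha, mul_zero, zero_smul, ← Finset.sum_smul,
    smul_eq_zero, one_ne_zero, or_false] at h
  exact_mod_cast h

/-- The coefficient `Tr(P_a X)` of a Hermitian operator `X` in the Pauli basis. It is encoded as a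
real number by discarding the imaginary part, which vanishes if `X` is Hermitian. -/
noncomputable def pauliCoeff (a : PauliIndex n) (X : Op n) : ℝ :=
  (pauli a * X).trace.re

lemma ofReal_pauliCoeff (a : PauliIndex n) {X : Op n} (hX : X.IsHermitian) :
    (pauliCoeff a X : ℂ) = (pauli a * X).trace :=
  ofReal_re_trace_mul (pauli_isHermitian a) hX

lemma abs_pauliCoeff_le (a : PauliIndex n) {X : Op n} (hX : X.PosSemidef) :
    |pauliCoeff a X| ≤ X.trace.re :=
  abs_re_trace_mul_le (pauli_isHermitian a) (pauli_mul_self a) hX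

lemma sum_pauliCoeff_sq {X : Op n} (hX : X.IsHermitian) :
    ((∑ a, pauliCoeff a X ^ 2 : ℝ) : ℂ) = 2 ^ n * (X * X).trace := by
  have h := congrArg (fun Y => (Y * X).trace) (sum_trace_pauli_smul_pauli X)
  simpa [Finset.sum_mul, trace_sum, ← ofReal_pauliCoeff _ hX, sq] using h

lemma sum_pauliCoeff_sq_le {X : Op n} (hX : X.PosSemidef) :
    ∑ a, pauliCoeff a X ^ 2 ≤ 2 ^ n * X.trace.re ^ 2 := by
  have h : ((∑ a, pauliCoeff a X ^ 2 : ℝ) : ℂ) ≤ 2 ^ n * X.trace ^ 2 := by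
    rw [sum_pauliCoeff_sq hX.isHermitian]
    exact mul_le_mul_of_nonneg_left (trace_mul_self_le_sq hX) (by positivity)
  rw [← ofReal_re_trace hX.isHermitian] at h
  exact_mod_cast h

end Pauli

section ChiSquare

variable {ι : Type*} [Fintype ι]

/-- The `χ²`-divergence of `q` from `p`. Since `x / 0 = 0`, it is meaningful only if `q` vanishes
wherever `p` does. -/
noncomputable def chiSq (p q : ι → ℝ) : ℝ :=
  ∑ s, (q s - p s) ^ 2 / p s

/-- The function that defines the triangular discrimination `∑ s, p_s φ(q_s / p_s)`, an
`f`-divergence. -/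
noncomputable def triDiscr (y : ℝ) : ℝ :=
  (1 - y) ^ 2 / (1 + y)

/-- The upper bound for `|1 - y| = √((1 + y) φ(y))`, where `φ` is `triDiscr`, that the inequality
between the arithmetic and the geometric mean yields with weight `α`. -/
noncomputable def deviationBound (α y : ℝ) : ℝ :=
  α / 2 * (1 + y) + triDiscr y / (2 * α)

lemma abs_one_sub_le_deviationBound {α y : ℝ} (hα : 0 < α) (hy : 0 ≤ y) :
    |1 - y| ≤ deviationBound α y := by
  have : 0 < 1 + y := by positivity
  have hgap : deviationBound α y - |1 - y| =
      (α * (1 + y) - |1 - y|) ^ 2 / (2 * α * (1 + y)) := by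
    rw [deviationBound, triDiscr, ← sq_abs (1 - y)]
    field_simp
    ring
  have := div_nonneg (sq_nonneg (α * (1 + y) - |1 - y|)) (by positivity : 0 ≤ 2 * α * (1 + y))
  linarith

lemma exists_triDiscr_mul_le {y : ℝ} (hy : 0 ≤ y) :
    ∃ c : ℝ, ∀ x : ℝ, 0 ≤ x →
      triDiscr (y * x) ≤ triDiscr y + c * (x - 1) + 4 * (x - 1) ^ 2 := by
  refine ⟨y * (1 - 4 / (1 + y) ^ 2), fun x hx => ?_⟩
  have : 0 < 1 + y := by positivity
  have hyx : 0 ≤ y * x := mul_nonneg hy hx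
  have hremainder : triDiscr (y * x) =
      triDiscr y + y * (1 - 4 / (1 + y) ^ 2) * (x - 1) +
        4 * (x - 1) ^ 2 * (y ^ 2 / ((1 + y) ^ 2 * (1 + y * x))) := by
    have hyx' : 1 + y * x ≠ 0 := by positivity
    simp only [triDiscr]
    field_simp
    ring
  have hratio : y ^ 2 / ((1 + y) ^ 2 * (1 + y * x)) ≤ 1 := by
    refine div_le_one_of_le₀ ?_ (by positivity)
    nlinarith [mul_nonneg (sq_nonneg (1 + y)) hyx]
  rw [hremainder]
  linarith [mul_le_of_le_one_right (by positivity : 0 ≤ 4 * (x - 1) ^ 2) hratio]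

lemma sum_mul_triDiscr_mul_div_le {p q : ι → ℝ} (hp : p ∈ stdSimplex ℝ ι)
    (hq : q ∈ stdSimplex ℝ ι) (hpq : ∀ s, p s = 0 → q s = 0) {y : ℝ} (hy : 0 ≤ y) :
    ∑ s, p s * triDiscr (y * (q s / p s)) ≤ triDiscr y + 4 * chiSq p q := by
  obtain ⟨c, hc⟩ := exists_triDiscr_mul_le hy
  have hterm : ∀ s, p s * triDiscr (y * (q s / p s)) ≤
      p s * triDiscr y + c * (q s - p s) + 4 * ((q s - p s) ^ 2 / p s) := by
    intro s
    rcases (hp.1 s).eq_or_lt with hs | hs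
    · simp [← hs, hpq s hs.symm]
    · refine (mul_le_mul_of_nonneg_left
        (hc _ (div_nonneg (hq.1 s) hs.le)) hs.le).trans_eq ?_
      field_simp
  refine (Finset.sum_le_sum fun s _ => hterm s).trans_eq ?_
  rw [Finset.sum_add_distrib, Finset.sum_add_distrib, ← Finset.sum_mul, ← Finset.mul_sum,
    ← Finset.mul_sum, Finset.sum_sub_distrib, hp.2, hq.2, chiSq]
  ring

lemma sum_mul_deviationBound_mul_div_le {p q : ι → ℝ} (hp : p ∈ stdSimplex ℝ ι)
    (hq : q ∈ stdSimplex ℝ ι) (hpq : ∀ s, p s = 0 → q s = 0) {α : ℝ} (hα : 0 < α) {y : ℝ}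
    (hy : 0 ≤ y) :
    ∑ s, p s * deviationBound α (y * (q s / p s)) ≤ deviationBound α y + 2 / α * chiSq p q := by
  have hlin : ∑ s, p s * (1 + y * (q s / p s)) = 1 + y := by
    simp only [mul_add, mul_one, mul_left_comm _ y, mul_div_cancel_of_imp' (hpq _),
      Finset.sum_add_distrib, ← Finset.mul_sum, hp.2, hq.2]
  calc ∑ s, p s * deviationBound α (y * (q s / p s))
      = α / 2 * ∑ s, p s * (1 + y * (q s / p s)) +
          (∑ s, p s * triDiscr (y * (q s / p s))) / (2 * α) := by
        rw [Finset.mul_sum, Finset.sum_div, ← Finset.sum_add_distrib]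
        exact Finset.sum_congr rfl fun s _ => by rw [deviationBound]; ring
    _ ≤ α / 2 * (1 + y) + (triDiscr y + 4 * chiSq p q) / (2 * α) := by
        rw [hlin]
        gcongr
        exact sum_mul_triDiscr_mul_div_le hp hq hpq hy
    _ = deviationBound α y + 2 / α * chiSq p q := by
        rw [deviationBound]
        ring

end ChiSquare

section Channels

variable {n : ℕ}

/-- Positive trace-preserving maps, the maps on operators that send states to states. Linearity is
not part of the definition. -/
structure IsPositiveTracePreserving (Φ : Op n → Op n) : Prop where
  posSemidef : ∀ {X : Op n}, X.PosSemidef → (Φ X).PosSemidef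
  trace_eq : ∀ X : Op n, (Φ X).trace = X.trace

/-- The image of a state under a positive trace-preserving map. -/
def IsPositiveTracePreserving.mapState {Φ : Op n → Op n} (hΦ : IsPositiveTracePreserving Φ)
    (ρ : State n) : State n where
  mat := Φ ρ.mat
  posSemidef := hΦ.posSemidef ρ.posSemidef
  trace_eq_one := (hΦ.trace_eq _).trans ρ.trace_eq_one

lemma Channel.isPositiveTracePreserving (C : Channel n) : IsPositiveTracePreserving C.map where
  posSemidef {X} hX :=
    (C.completelyPositive 1 (X.submatrix Prod.snd Prod.snd) (hX.submatrix _)).submatrix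
      fun s : Basis n => ((0 : Fin 1), s)
  trace_eq := C.tracePreserving

lemma isPositiveTracePreserving_pauliChannel {q : PauliIndex n → ℝ}
    (hq : q ∈ stdSimplex ℝ (PauliIndex n)) : IsPositiveTracePreserving (pauliChannel q) where
  posSemidef {X} hX := by
    refine posSemidef_sum _ fun a _ => PosSemidef.smul ?_ (by exact_mod_cast hq.1 a)
    have h := hX.mul_mul_conjTranspose_same (pauli a)
    rwa [(pauli_isHermitian a).eq] at h
  trace_eq X := by
    have hconj : ∀ a : PauliIndex n, (pauli a * X * pauli a).trace = X.trace := fun a => by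
      rw [trace_mul_comm, ← mul_assoc, pauli_mul_self, one_mul]
    simp only [pauliChannel, trace_sum, trace_smul, hconj, ← Finset.sum_smul]
    rw [← Complex.ofReal_sum, hq.2, Complex.ofReal_one, one_smul]

/-- The completely depolarizing channel, the one whose nontrivial Pauli eigenvalues all vanish. -/
noncomputable def depolarizing (X : Op n) : Op n :=
  (X.trace / 2 ^ n) • 1

lemma isPositiveTracePreserving_depolarizing :
    IsPositiveTracePreserving (depolarizing (n := n)) where
  posSemidef hX := PosSemidef.one.smul (div_nonneg hX.trace_nonneg (by positivity))
  trace_eq X := by simp [depolarizing, trace_one]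

/-- The error rates of the Pauli channel all of whose nontrivial eigenvalues vanish, except for
`λ_a = δ`. -/
noncomputable def spikeRates (a : PauliIndex n) (δ : ℝ) (b : PauliIndex n) : ℝ :=
  (1 + δ * (-1) ^ (symp a b).val) / 4 ^ n

lemma card_pauliIndex : Fintype.card (PauliIndex n) = 4 ^ n := by
  simp [Fintype.card_pi]

lemma card_compl_zero : (({0}ᶜ : Finset (PauliIndex n)).card : ℝ) = 4 ^ n - 1 := by
  rw [Finset.card_compl, Finset.card_singleton, card_pauliIndex,
    Nat.cast_sub (Nat.one_le_pow _ _ (by norm_num))]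
  simp

lemma spikeRates_mem_stdSimplex {a : PauliIndex n} (ha : a ≠ 0) {δ : ℝ} (hδ : |δ| ≤ 1) :
    spikeRates a δ ∈ stdSimplex ℝ (PauliIndex n) := by
  refine ⟨fun b => div_nonneg ?_ (by positivity), ?_⟩
  · obtain ⟨hneg, hpos⟩ := abs_le.mp hδ
    rcases neg_one_pow_eq_or ℝ (symp a b).val with h | h <;> rw [h] <;> linarith
  · simp only [spikeRates, ← Finset.sum_div, Finset.sum_add_distrib, ← Finset.mul_sum, sum_sign ha,
      Finset.sum_const, Finset.card_univ, card_pauliIndex]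
    simp

lemma symp_comm (a b : PauliIndex n) : symp a b = symp b a :=
  Finset.sum_congr rfl fun _ _ => by ring

lemma pauliEigenvalue_spikeRates {a : PauliIndex n} (ha : a ≠ 0) (δ : ℝ) :
    pauliEigenvalue (spikeRates a δ) a = δ := by
  have hterm : ∀ b, spikeRates a δ b * (-1) ^ (symp b a).val =
      ((-1) ^ (symp a b).val + δ) / 4 ^ n := by
    intro b
    rw [symp_comm b a, spikeRates]
    rcases neg_one_pow_eq_or ℝ (symp a b).val with h | h <;> rw [h] <;> ring
  simp only [pauliEigenvalue, hterm, ← Finset.sum_div, Finset.sum_add_distrib, sum_sign ha,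
    Finset.sum_const, Finset.card_univ, card_pauliIndex]
  simp

lemma pauliChannel_spikeRates (a : PauliIndex n) (δ : ℝ) (X : Op n) :
    pauliChannel (spikeRates a δ) X =
      depolarizing X + (δ * (pauli a * X).trace / 2 ^ n) • pauli a := by
  have hpow : (4 : ℂ) ^ n = 2 ^ n * 2 ^ n := by rw [← mul_pow]; norm_num
  calc pauliChannel (spikeRates a δ) X
      = ((4 : ℂ) ^ n)⁻¹ • (∑ b : PauliIndex n, pauli b * X * pauli b +
          (δ : ℂ) • ∑ b, (-1 : ℂ) ^ (symp a b).val • (pauli b * X * pauli b)) := by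
        rw [Finset.smul_sum, ← Finset.sum_add_distrib, Finset.smul_sum]
        refine Finset.sum_congr rfl fun b _ => ?_
        rw [spikeRates]
        push_cast
        rw [smul_smul, div_eq_inv_mul, mul_smul, add_smul, one_smul]
    _ = depolarizing X + (δ * (pauli a * X).trace / 2 ^ n) • pauli a := by
        rw [sum_pauli_conj, sum_sign_smul_pauli_conj, smul_add, smul_smul, smul_smul, smul_smul,
          depolarizing, hpow]
        congr 2 <;> field_simp

end Channels

section Rounds

variable {n : ℕ}

lemma POVM.sum_trace (F : POVM n) : ∑ s, (F.elt s).trace.re = 2 ^ n := by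
  rw [← Complex.re_sum, ← trace_sum, F.sum_eq_one, trace_one, Complex.natCast_re]
  simp

namespace Round

/-- The reason why concatenation does not help: interleaving channels only affects which state the
last query acts on. -/
lemma exists_output_eq (r : Round n) {Λ : Op n → Op n} (hΛ : IsPositiveTracePreserving Λ) :
    ∃ ρ : State n, r.output Λ = Λ ρ.mat := by
  suffices h : ∀ (l : List (Channel n)) (ρ : State n),
      ∃ ρ' : State n, l.foldl (fun σ C => Λ (C.map σ)) (Λ ρ.mat) = Λ ρ'.mat from
    h r.processing r.input
  intro l
  induction l with
  | nil => exact fun ρ => ⟨ρ, rfl⟩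
  | cons C _ ih => exact fun ρ => ih (C.isPositiveTracePreserving.mapState (hΛ.mapState ρ))

lemma outcomeProb_mem_stdSimplex (r : Round n) {Λ : Op n → Op n}
    (hΛ : IsPositiveTracePreserving Λ) :
    r.outcomeProb Λ ∈ stdSimplex ℝ (Fin r.povm.outcomes) := by
  obtain ⟨ρ, hρ⟩ := r.exists_output_eq hΛ
  refine ⟨fun s => ?_, ?_⟩
  · rw [outcomeProb, hρ]
    exact re_trace_mul_nonneg (r.povm.posSemidef s) (hΛ.posSemidef ρ.posSemidef)
  · simp only [outcomeProb, hρ]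
    rw [← Complex.re_sum, ← trace_sum, ← Finset.sum_mul, r.povm.sum_eq_one, one_mul,
      hΛ.trace_eq, ρ.trace_eq_one, Complex.one_re]

lemma outcomeProb_depolarizing (r : Round n) (s : Fin r.povm.outcomes) :
    r.outcomeProb depolarizing s = (r.povm.elt s).trace.re / 2 ^ n := by
  obtain ⟨ρ, hρ⟩ := r.exists_output_eq isPositiveTracePreserving_depolarizing
  rw [outcomeProb, hρ, depolarizing, ρ.trace_eq_one, mul_smul_comm, mul_one, trace_smul,
    smul_eq_mul, one_div_mul_eq_div]
  exact_mod_cast Complex.div_ofReal_re (r.povm.elt s).trace (2 ^ n)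

lemma outcomeProb_eq_zero_of_depolarizing (r : Round n) (Λ : Op n → Op n)
    {s : Fin r.povm.outcomes} (hs : r.outcomeProb depolarizing s = 0) :
    r.outcomeProb Λ s = 0 := by
  have hF := r.povm.posSemidef s
  have hzero : (r.povm.elt s).trace = 0 := by
    rw [outcomeProb_depolarizing, div_eq_zero_iff, or_iff_left (by positivity)] at hs
    rw [← ofReal_re_trace hF.isHermitian, hs, Complex.ofReal_zero]
  rw [outcomeProb, hF.trace_eq_zero_iff.mp hzero, zero_mul, trace_zero, Complex.zero_re]

lemma exists_outcomeProb_spikeRates (r : Round n) {a : PauliIndex n} (ha : a ≠ 0) {δ : ℝ}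
    (hδ : |δ| ≤ 1) : ∃ t : ℝ, |t| ≤ |δ| ∧ ∀ s, r.outcomeProb (pauliChannel (spikeRates a δ)) s =
      r.outcomeProb depolarizing s + t * pauliCoeff a (r.povm.elt s) / 2 ^ n := by
  obtain ⟨ρ, hρ⟩ := r.exists_output_eq
    (isPositiveTracePreserving_pauliChannel (spikeRates_mem_stdSimplex ha hδ))
  refine ⟨δ * pauliCoeff a ρ.mat, ?_, fun s => ?_⟩
  · have hcoeff := abs_pauliCoeff_le a ρ.posSemidef
    rw [ρ.trace_eq_one, Complex.one_re] at hcoeff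
    rw [abs_mul]
    exact mul_le_of_le_one_right (abs_nonneg _) hcoeff
  · rw [outcomeProb_depolarizing, outcomeProb, hρ, pauliChannel_spikeRates, depolarizing,
      ρ.trace_eq_one, mul_add, mul_smul_comm, mul_one, mul_smul_comm, trace_add, trace_smul,
      trace_smul, trace_mul_comm (r.povm.elt s) (pauli a),
      ← ofReal_re_trace (r.povm.posSemidef s).isHermitian,
      ← ofReal_pauliCoeff a (r.povm.posSemidef s).isHermitian,
      ← ofReal_pauliCoeff a ρ.posSemidef.isHermitian]
    have hpow : (2 : ℂ) ^ n = ((2 ^ n : ℝ) : ℂ) := by push_cast; rfl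
    simp only [hpow, smul_eq_mul, one_div_mul_eq_div, ← Complex.ofReal_mul, ← Complex.ofReal_div,
      ← Complex.ofReal_add, Complex.ofReal_re]
    ring

lemma chiSq_outcomeProb_spikeRates_le (r : Round n) {a : PauliIndex n} (ha : a ≠ 0) {δ : ℝ}
    (hδ : |δ| ≤ 1) :
    chiSq (r.outcomeProb depolarizing) (r.outcomeProb (pauliChannel (spikeRates a δ))) ≤
      δ ^ 2 / 2 ^ n * ∑ s, pauliCoeff a (r.povm.elt s) ^ 2 / (r.povm.elt s).trace.re := by
  obtain ⟨t, ht, hprob⟩ := r.exists_outcomeProb_spikeRates ha hδ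
  calc chiSq (r.outcomeProb depolarizing) (r.outcomeProb (pauliChannel (spikeRates a δ)))
      = t ^ 2 / 2 ^ n * ∑ s, pauliCoeff a (r.povm.elt s) ^ 2 / (r.povm.elt s).trace.re := by
        rw [chiSq, Finset.mul_sum]
        refine Finset.sum_congr rfl fun s _ => ?_
        rw [hprob, add_sub_cancel_left, outcomeProb_depolarizing]
        field_simp
    _ ≤ δ ^ 2 / 2 ^ n * ∑ s, pauliCoeff a (r.povm.elt s) ^ 2 / (r.povm.elt s).trace.re := by
        gcongr ?_ / _ * _
        · exact Finset.sum_nonneg fun s _ =>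
            div_nonneg (sq_nonneg _) (re_trace_nonneg (r.povm.posSemidef s))
        · exact sq_le_sq.mpr ht

lemma sum_chiSq_outcomeProb_spikeRates_le (r : Round n) {δ : ℝ} (hδ : |δ| ≤ 1) :
    ∑ a ∈ ({0}ᶜ : Finset (PauliIndex n)),
        chiSq (r.outcomeProb depolarizing) (r.outcomeProb (pauliChannel (spikeRates a δ))) ≤
      2 ^ n * δ ^ 2 := by
  have hF : ∀ s, 0 ≤ (r.povm.elt s).trace.re := fun s => re_trace_nonneg (r.povm.posSemidef s)
  calc ∑ a ∈ ({0}ᶜ : Finset (PauliIndex n)),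
        chiSq (r.outcomeProb depolarizing) (r.outcomeProb (pauliChannel (spikeRates a δ)))
      ≤ ∑ a ∈ ({0}ᶜ : Finset (PauliIndex n)),
          δ ^ 2 / 2 ^ n * ∑ s, pauliCoeff a (r.povm.elt s) ^ 2 / (r.povm.elt s).trace.re :=
        Finset.sum_le_sum fun a ha =>
          r.chiSq_outcomeProb_spikeRates_le (by simpa using ha) hδ
    _ ≤ ∑ a : PauliIndex n,
          δ ^ 2 / 2 ^ n * ∑ s, pauliCoeff a (r.povm.elt s) ^ 2 / (r.povm.elt s).trace.re :=
        Finset.sum_le_univ_sum_of_nonneg fun a => mul_nonneg (by positivity) <|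
          Finset.sum_nonneg fun s _ => div_nonneg (sq_nonneg _) (hF s)
    _ = δ ^ 2 / 2 ^ n *
          ∑ s, (∑ a, pauliCoeff a (r.povm.elt s) ^ 2) / (r.povm.elt s).trace.re := by
        rw [← Finset.mul_sum, Finset.sum_comm]
        simp only [Finset.sum_div]
    _ ≤ δ ^ 2 / 2 ^ n * ∑ s, 2 ^ n * (r.povm.elt s).trace.re := by
        gcongr with s
        refine div_le_of_le_mul₀ (hF s) (mul_nonneg (by positivity) (hF s)) ?_
        rw [mul_assoc, ← sq]
        exact sum_pauliCoeff_sq_le (r.povm.posSemidef s)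
    _ = 2 ^ n * δ ^ 2 := by
        rw [← Finset.mul_sum, r.povm.sum_trace]
        field_simp

end Round

end Rounds

section LearningTrees

variable {n T : ℕ}

namespace LearningTree

section Prob

variable {Λ : Op n → Op n} (hΛ : IsPositiveTracePreserving Λ)

include hΛ

lemma prob_nonneg (E : Set (PauliIndex n → ℝ)) (t : LearningTree n T) : 0 ≤ t.prob Λ E := by
  induction t with
  | leaf estimate =>
    rw [prob]
    split_ifs <;> norm_num
  | node r next ih =>
    exact Finset.sum_nonneg fun s _ => mul_nonneg ((r.outcomeProb_mem_stdSimplex hΛ).1 s) (ih s)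

lemma prob_add_prob_le_one {E E' : Set (PauliIndex n → ℝ)} (hE : Disjoint E E')
    (t : LearningTree n T) : t.prob Λ E + t.prob Λ E' ≤ 1 := by
  induction t with
  | leaf estimate =>
    have hmem : ¬ (estimate ∈ E ∧ estimate ∈ E') := fun h => Set.disjoint_left.mp hE h.1 h.2
    rw [prob, prob]
    split_ifs <;> first | tauto | norm_num
  | node r next ih =>
    obtain ⟨hnonneg, hsum⟩ := r.outcomeProb_mem_stdSimplex hΛ
    simp only [prob]
    rw [← Finset.sum_add_distrib, ← hsum]
    refine Finset.sum_le_sum fun s _ => ?_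
    rw [← mul_add]
    exact mul_le_of_le_one_right (hnonneg s) (ih s)

lemma prob_le_one (E : Set (PauliIndex n → ℝ)) (t : LearningTree n T) : t.prob Λ E ≤ 1 :=
  (le_add_of_nonneg_right (t.prob_nonneg hΛ ∅)).trans
    (t.prob_add_prob_le_one hΛ (Set.disjoint_empty E))

end Prob

/-- The sum of the `χ²`-divergences of `Λ` from `Λ₀` in the rounds along a path through the tree,
averaged over the path taken if the unknown channel is `Λ₀`. -/
noncomputable def expectedChiSq (Λ₀ Λ : Op n → Op n) : {T : ℕ} → LearningTree n T → ℝ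
  | _, .leaf _ => 0
  | _, .node r next => chiSq (r.outcomeProb Λ₀) (r.outcomeProb Λ) +
      ∑ s, r.outcomeProb Λ₀ s * (next s).expectedChiSq Λ₀ Λ

lemma sum_expectedChiSq_le {ι : Type*} {S : Finset ι} {Λ₀ : Op n → Op n} {Λ : ι → Op n → Op n}
    {V : ℝ} (hΛ₀ : IsPositiveTracePreserving Λ₀)
    (hV : ∀ r : Round n, ∑ i ∈ S, chiSq (r.outcomeProb Λ₀) (r.outcomeProb (Λ i)) ≤ V)
    (t : LearningTree n T) : ∑ i ∈ S, t.expectedChiSq Λ₀ (Λ i) ≤ T * V := by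
  induction t with
  | leaf => simp [expectedChiSq]
  | @node T r next ih =>
    obtain ⟨hnonneg, hsum⟩ := r.outcomeProb_mem_stdSimplex hΛ₀
    calc ∑ i ∈ S, (node r next).expectedChiSq Λ₀ (Λ i)
        = ∑ i ∈ S, chiSq (r.outcomeProb Λ₀) (r.outcomeProb (Λ i)) +
            ∑ s, r.outcomeProb Λ₀ s * ∑ i ∈ S, (next s).expectedChiSq Λ₀ (Λ i) := by
          simp only [expectedChiSq, Finset.sum_add_distrib, Finset.mul_sum]
          rw [Finset.sum_comm]
      _ ≤ V + ∑ s, r.outcomeProb Λ₀ s * (T * V) :=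
          add_le_add (hV r) (Finset.sum_le_sum fun s _ => by gcongr; exacts [hnonneg s, ih s])
      _ = (T + 1 : ℕ) * V := by
          rw [← Finset.sum_mul, hsum]
          push_cast
          ring

section Comparison

variable {Λ₀ Λ : Op n → Op n} (hΛ₀ : IsPositiveTracePreserving Λ₀)
  (hΛ : IsPositiveTracePreserving Λ)
  (hac : ∀ (r : Round n) (s), r.outcomeProb Λ₀ s = 0 → r.outcomeProb Λ s = 0)
  {α : ℝ} (hα : 0 < α) (E : Set (PauliIndex n → ℝ))

include hΛ₀ hΛ hac hα

/-- Here `y` is the likelihood ratio of the outcomes on the way to the root of `t`. Carrying it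
along makes the induction work: a round multiplies `y` by a factor of mean `1`, so the linear part
of `deviationBound` averages out, and the quadratic one contributes a `χ²`-divergence. -/
lemma mul_prob_sub_prob_le (t : LearningTree n T) {y : ℝ} (hy : 0 ≤ y) :
    y * t.prob Λ E - t.prob Λ₀ E ≤
      deviationBound α y + 2 / α * t.expectedChiSq Λ₀ Λ := by
  induction t generalizing y with
  | leaf estimate =>
    have hdev := abs_one_sub_le_deviationBound hα hy
    rw [prob, prob, expectedChiSq, mul_zero, add_zero]
    split_ifs
    · linarith [neg_abs_le (1 - y)]
    · linarith [abs_nonneg (1 - y)]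
  | node r next ih =>
    have hp := r.outcomeProb_mem_stdSimplex hΛ₀
    have hq := r.outcomeProb_mem_stdSimplex hΛ
    set p := r.outcomeProb Λ₀
    set q := r.outcomeProb Λ
    calc y * (node r next).prob Λ E - (node r next).prob Λ₀ E
        = ∑ s, p s * (y * (q s / p s) * (next s).prob Λ E - (next s).prob Λ₀ E) := by
          simp only [prob]
          rw [Finset.mul_sum, ← Finset.sum_sub_distrib]
          refine Finset.sum_congr rfl fun s _ => ?_
          rw [mul_sub, ← mul_assoc (p s), mul_left_comm (p s) y,
            mul_div_cancel_of_imp' (hac r s), mul_assoc]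
      _ ≤ ∑ s, p s * (deviationBound α (y * (q s / p s)) +
            2 / α * (next s).expectedChiSq Λ₀ Λ) :=
          Finset.sum_le_sum fun s _ => mul_le_mul_of_nonneg_left
            (ih s (mul_nonneg hy (div_nonneg (hq.1 s) (hp.1 s)))) (hp.1 s)
      _ = ∑ s, p s * deviationBound α (y * (q s / p s)) +
            2 / α * ∑ s, p s * (next s).expectedChiSq Λ₀ Λ := by
          simp only [mul_add, Finset.sum_add_distrib, mul_left_comm _ (2 / α), ← Finset.mul_sum]
      _ ≤ deviationBound α y + 2 / α * chiSq p q +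
            2 / α * ∑ s, p s * (next s).expectedChiSq Λ₀ Λ :=
          add_le_add_left (sum_mul_deviationBound_mul_div_le hp hq (hac r) hα hy) _
      _ = deviationBound α y + 2 / α * (node r next).expectedChiSq Λ₀ Λ := by
          rw [expectedChiSq, mul_add, add_assoc]

lemma prob_sub_prob_le (t : LearningTree n T) :
    t.prob Λ E - t.prob Λ₀ E ≤ α + 2 / α * t.expectedChiSq Λ₀ Λ := by
  have h := t.mul_prob_sub_prob_le hΛ₀ hΛ hac hα E zero_le_one
  rw [deviationBound, triDiscr, sub_self, zero_pow two_ne_zero, zero_div, zero_div] at h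
  linarith

end Comparison

end LearningTree

/-- The estimates of the Pauli eigenvalues of the channel with error rates `q` that have error less
than `ε`. -/
def accurateEstimates (ε : ℝ) (q : PauliIndex n → ℝ) : Set (PauliIndex n → ℝ) :=
  {est | ∀ b, |est b - pauliEigenvalue q b| < ε}

lemma disjoint_accurateEstimates {ε : ℝ} {q q' : PauliIndex n → ℝ} {b : PauliIndex n}
    (h : 2 * ε ≤ |pauliEigenvalue q b - pauliEigenvalue q' b|) :
    Disjoint (accurateEstimates ε q) (accurateEstimates ε q') := by
  refine Set.disjoint_left.mpr fun est hest hest' => ?_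
  have htriangle := abs_sub_le (pauliEigenvalue q b) (est b) (pauliEigenvalue q' b)
  rw [abs_sub_comm _ (est b)] at htriangle
  linarith [hest b, hest' b]

namespace LearningTree

/-- The probability that the tree estimates all Pauli eigenvalues to error `ε`, if the unknown
channel has Pauli error rates `q`. -/
noncomputable def successProb (t : LearningTree n T) (ε : ℝ) (q : PauliIndex n → ℝ) : ℝ :=
  t.prob (pauliChannel q) (accurateEstimates ε q)

lemma successProb_spikeRates_sub_le (t : LearningTree n T) {a : PauliIndex n} (ha : a ≠ 0)
    {δ : ℝ} (hδ : |δ| ≤ 1) {α : ℝ} (hα : 0 < α) (ε : ℝ) :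
    t.successProb ε (spikeRates a δ) -
        t.prob depolarizing (accurateEstimates ε (spikeRates a δ)) ≤
      α + 2 / α * t.expectedChiSq depolarizing (pauliChannel (spikeRates a δ)) :=
  t.prob_sub_prob_le isPositiveTracePreserving_depolarizing
    (isPositiveTracePreserving_pauliChannel (spikeRates_mem_stdSimplex ha hδ))
    (fun r _ => r.outcomeProb_eq_zero_of_depolarizing _) hα _

/-- Le Cam's two-point method: the tree cannot succeed for both `λ_a = ε` and `λ_a = -ε` on the same
outcomes, so under the depolarizing channel the two events have total probability at most `1`. -/
lemma successProb_spikeRates_add_le (t : LearningTree n T) {a : PauliIndex n} (ha : a ≠ 0)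
    {ε : ℝ} (hε : |ε| ≤ 1) {α : ℝ} (hα : 0 < α) :
    t.successProb ε (spikeRates a ε) + t.successProb ε (spikeRates a (-ε)) ≤
      1 + 2 * α + 2 / α * (t.expectedChiSq depolarizing (pauliChannel (spikeRates a ε)) +
        t.expectedChiSq depolarizing (pauliChannel (spikeRates a (-ε)))) := by
  have hplus := t.successProb_spikeRates_sub_le ha hε hα ε
  have hminus := t.successProb_spikeRates_sub_le ha ((abs_neg ε).trans_le hε) hα ε
  have hdisjoint := t.prob_add_prob_le_one isPositiveTracePreserving_depolarizing
    (disjoint_accurateEstimates (ε := ε) (q := spikeRates a ε) (q' := spikeRates a (-ε)) (b := a)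
      (by
        rw [pauliEigenvalue_spikeRates ha, pauliEigenvalue_spikeRates ha]
        linarith [le_abs_self (ε - -ε)]))
  linarith

lemma sum_expectedChiSq_spikeRates_le (t : LearningTree n T) {δ : ℝ} (hδ : |δ| ≤ 1) :
    ∑ a ∈ ({0}ᶜ : Finset (PauliIndex n)),
        t.expectedChiSq depolarizing (pauliChannel (spikeRates a δ)) ≤ T * (2 ^ n * δ ^ 2) :=
  sum_expectedChiSq_le isPositiveTracePreserving_depolarizing
    (fun r => r.sum_chiSq_outcomeProb_spikeRates_le hδ) t

lemma sum_successProb_spikeRates_le (t : LearningTree n T) {ε : ℝ} (hε0 : 0 < ε) (hε1 : ε ≤ 1)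
    {α : ℝ} (hα : 0 < α) :
    ∑ i ∈ ({0}ᶜ : Finset (PauliIndex n)) ×ˢ {ε, -ε}, t.successProb ε (spikeRates i.1 i.2) ≤
      (4 ^ n - 1) * (1 + 2 * α) + 4 / α * (T * (2 ^ n * ε ^ 2)) := by
  have hε : |ε| ≤ 1 := (abs_of_pos hε0).trans_le hε1
  set χ : ℝ → PauliIndex n → ℝ := fun δ a =>
    t.expectedChiSq depolarizing (pauliChannel (spikeRates a δ))
  calc ∑ i ∈ ({0}ᶜ : Finset (PauliIndex n)) ×ˢ {ε, -ε}, t.successProb ε (spikeRates i.1 i.2)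
      = ∑ a ∈ ({0}ᶜ : Finset (PauliIndex n)),
          (t.successProb ε (spikeRates a ε) + t.successProb ε (spikeRates a (-ε))) := by
        simp only [Finset.sum_product, Finset.sum_pair (self_ne_neg.mpr hε0.ne')]
    _ ≤ ∑ a ∈ ({0}ᶜ : Finset (PauliIndex n)), (1 + 2 * α + 2 / α * (χ ε a + χ (-ε) a)) :=
        Finset.sum_le_sum fun a ha =>
          t.successProb_spikeRates_add_le (by simpa using ha) hε hα
    _ = (4 ^ n - 1) * (1 + 2 * α) + 2 / α * (∑ a ∈ {0}ᶜ, χ ε a + ∑ a ∈ {0}ᶜ, χ (-ε) a) := by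
        rw [Finset.sum_add_distrib, Finset.sum_const, nsmul_eq_mul, card_compl_zero,
          ← Finset.mul_sum, Finset.sum_add_distrib]
    _ ≤ (4 ^ n - 1) * (1 + 2 * α) +
          2 / α * (T * (2 ^ n * ε ^ 2) + T * (2 ^ n * (-ε) ^ 2)) := by
        gcongr
        · exact t.sum_expectedChiSq_spikeRates_le hε
        · exact t.sum_expectedChiSq_spikeRates_le ((abs_neg ε).trans_le hε)
    _ = (4 ^ n - 1) * (1 + 2 * α) + 4 / α * (T * (2 ^ n * ε ^ 2)) := by ring

end LearningTree

end LearningTrees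

section Protocols

variable {n T : ℕ}

namespace Protocol.Solves

lemma card_mul_le {ι : Type*} {S : Finset ι} {q : ι → PauliIndex n → ℝ} {ε p B : ℝ}
    {A : Protocol n T} (hA : A.Solves ε p) (hq : ∀ i ∈ S, q i ∈ stdSimplex ℝ (PauliIndex n))
    (hB : ∀ t : LearningTree n T, ∑ i ∈ S, t.successProb ε (q i) ≤ B) : S.card * p ≤ B := by
  have hA_summable : Summable fun t => (A t).toReal := ENNReal.summable_toReal A.tsum_coe_ne_top
  have hA_tsum : ∑' t, (A t).toReal = 1 := by
    rw [← ENNReal.tsum_toReal_eq A.apply_ne_top, A.tsum_coe, ENNReal.toReal_one]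
  have hsummable : ∀ i ∈ S, Summable fun t => (A t).toReal * t.successProb ε (q i) := by
    intro i hi
    have hΛ := isPositiveTracePreserving_pauliChannel (hq i hi)
    exact hA_summable.of_nonneg_of_le
      (fun t => mul_nonneg ENNReal.toReal_nonneg (t.prob_nonneg hΛ _))
      (fun t => mul_le_of_le_one_right ENNReal.toReal_nonneg (t.prob_le_one hΛ _))
  calc (S.card : ℝ) * p = ∑ _i ∈ S, p := by rw [Finset.sum_const, nsmul_eq_mul]
    _ ≤ ∑ i ∈ S, ∑' t, (A t).toReal * t.successProb ε (q i) :=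
        Finset.sum_le_sum fun i hi => hA (q i) (hq i hi)
    _ = ∑' t, (A t).toReal * ∑ i ∈ S, t.successProb ε (q i) := by
        rw [← Summable.tsum_finsetSum hsummable]
        simp only [Finset.mul_sum]
    _ ≤ ∑' t, (A t).toReal * B := by
        refine Summable.tsum_le_tsum
          (fun t => mul_le_mul_of_nonneg_left (hB t) ENNReal.toReal_nonneg) ?_
          (hA_summable.mul_right B)
        simpa only [Finset.mul_sum] using summable_sum hsummable
    _ = B := by rw [tsum_mul_right, hA_tsum, one_mul]

lemma mul_sub_le {A : Protocol n T} {ε p : ℝ} (hA : A.Solves ε p) (hε0 : 0 < ε) (hε1 : ε ≤ 1)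
    {α : ℝ} (hα : 0 < α) :
    (4 ^ n - 1) * (2 * p - 1 - 2 * α) ≤ 4 / α * (T * (2 ^ n * ε ^ 2)) := by
  have hmem : ∀ i ∈ ({0}ᶜ : Finset (PauliIndex n)) ×ˢ {ε, -ε},
      spikeRates i.1 i.2 ∈ stdSimplex ℝ (PauliIndex n) := by
    intro i hi
    obtain ⟨ha, hδ⟩ := Finset.mem_product.mp hi
    refine spikeRates_mem_stdSimplex (by simpa using ha) (le_of_eq_of_le ?_ hε1)
    rw [abs_eq hε0.le]
    simpa using hδ
  have hbound := hA.card_mul_le hmem fun t => t.sum_successProb_spikeRates_le hε0 hε1 hα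
  rw [Finset.card_product, Finset.card_pair (self_ne_neg.mpr hε0.ne'), Nat.cast_mul,
    card_compl_zero, Nat.cast_two] at hbound
  linarith

lemma two_pow_div_sq_le {A : Protocol n T} {ε p : ℝ} (hA : A.Solves ε p) (hn : 1 ≤ n)
    (hε0 : 0 < ε) (hε1 : ε ≤ 1) (hp : 1 / 2 < p) :
    (2 * p - 1) ^ 2 / 64 * (2 ^ n / ε ^ 2) ≤ T := by
  have hgap : 0 < 2 * p - 1 := by linarith
  have hbound := hA.mul_sub_le hε0 hε1 (α := (2 * p - 1) / 4) (by positivity)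
  set γ := 2 * p - 1
  have hcount : (2 : ℝ) ^ n * (2 ^ n / 2) ≤ 4 ^ n - 1 := by
    have hpow : (4 : ℝ) ^ n = 2 ^ n * 2 ^ n := by rw [← mul_pow]; norm_num
    have htwo : (2 : ℝ) ≤ 2 ^ n := le_self_pow₀ one_le_two (by lia)
    nlinarith
  have hscaled : 2 ^ n * (2 ^ n * γ ^ 2 / 64) ≤ 2 ^ n * (T * ε ^ 2) :=
    calc 2 ^ n * (2 ^ n * γ ^ 2 / 64)
        = γ / 16 * (2 ^ n * (2 ^ n / 2) * (γ - 2 * (γ / 4))) := by ring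
      _ ≤ γ / 16 * ((4 ^ n - 1) * (γ - 2 * (γ / 4))) := by
          gcongr
          linarith
      _ ≤ γ / 16 * (4 / (γ / 4) * (T * (2 ^ n * ε ^ 2))) := by gcongr
      _ = 2 ^ n * (T * ε ^ 2) := by
          field_simp
          norm_num
  have hcancel : 2 ^ n * γ ^ 2 / 64 ≤ T * ε ^ 2 := le_of_mul_le_mul_left hscaled (by positivity)
  rw [div_mul_div_comm, div_le_iff₀ (by positivity)]
  linarith

end Protocol.Solves

end Protocols

end PauliLearning

theorem theorem3p1 (p : ℝ) (hp : 1 / 2 < p) :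
    ∃ c : ℝ, 0 < c ∧
      ∀ n : ℕ, 1 ≤ n → ∀ ε : ℝ, 0 < ε → ε ≤ 1 →
        ∀ (T : ℕ) (A : PauliLearning.Protocol n T),
          PauliLearning.Protocol.Solves A ε p → c * (2 ^ n / ε ^ 2) ≤ (T : ℝ) := by
  have hgap : 0 < 2 * p - 1 := by linarith
  exact ⟨(2 * p - 1) ^ 2 / 64, by positivity, fun n hn ε hε0 hε1 T A hA =>
    hA.two_pow_div_sq_le hn hε0 hε1 hp⟩
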